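/- Let $E$ be a real separable Banach space. A random vector $X$ in $E$ is symmetric if $-X$ has the same distribution as $X$. For symmetric $E$-valued random vectors $X,Y$ and constants $\kappa,\lambda\ge 1$, we say that $X$ is $(\kappa,\lambda)$-dominated by $Y$ if $$\mathbb{P}(X\notin K)\le \kappa\,\mathbb{P}(\lambda Y\notin K)\quad\text{for every closed convex symmetric set } K\subset E.$$ Theorem. Let $\kappa,\lambda\ge 1$, let $X_1,\dots,X_n$ be independent symmetric random vectors in $E$, and let $Y_1,\dots,Y_n$ be independent symmetric random vectors in $E$ (the two families may be defined on different probability spaces; if they are on the same one, nothing is assumed about their joint distribution). Suppose that $X_i$ is $(\kappa,\lambda)$-dominated by $Y_i$ for each $i=1,\dots,n$. Then for every $0<\alpha\le 1$ the sum $X_1+\dots+X_n$ is $(16\alpha^{-1}\lceil\kappa\rceil,\ (1+\alpha)\lceil\kappa\rceil\lambda)$-dominated by the sum $Y_1+\dots+Y_n$. -/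

import Mathlib

open MeasureTheory ProbabilityTheory

/-- A random vector `X` is symmetric: `-X` has the same distribution as `X`. -/
def IsSymmetricRV {Ω E : Type*} [MeasurableSpace Ω] [NormedAddCommGroup E] [MeasurableSpace E]
    (X : Ω → E) (μ : Measure Ω) : Prop :=
  IdentDistrib (fun ω => -X ω) X μ μ

/-- `X` (a random vector under `μ`) is `(κ, lam)`-dominated by `Y` (a random vector under `ν`):
`P(X ∉ K) ≤ κ P(lam Y ∉ K)` for every closed convex symmetric set `K`. -/
def IsDominatedBy {Ω Ω' E : Type*} [MeasurableSpace Ω] [MeasurableSpace Ω']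
    [NormedAddCommGroup E] [NormedSpace ℝ E]
    (κ lam : ℝ) (X : Ω → E) (μ : Measure Ω) (Y : Ω' → E) (ν : Measure Ω') : Prop :=
  ∀ K : Set E, IsClosed K → Convex ℝ K → (∀ x ∈ K, -x ∈ K) →
    μ.real {ω | X ω ∉ K} ≤ κ * ν.real {ω | lam • Y ω ∉ K}

/-!
The idea is to compare expectations of convex functions first and to return to tails at the end.

For an even convex `φ` and an independent symmetric `S`, the function `x ↦ 𝔼 φ (x + S)` is again
even and convex, so its sublevel sets are convex and symmetric and domination applies to it, through
the layer cake formula. Replacing the summands one at a time therefore gives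
`𝔼 φ (∑ Xᵢ) ≤ 𝔼 φ (m λ ∑ Yᵢ)` with `m = ⌈κ⌉`; the factor `κ` disappears because convexity gives
`φ x - φ 0 ≤ (φ (m x) - φ 0) / m`. For a continuous seminorm `q`, this is applied to the excess
`φ = (q - m λ)₊`, and Markov's inequality bounds the tail of `q (∑ Xᵢ)` at `(1 + α) m λ`.

An expected excess is not controlled by the tail `p = ℙ(q (∑ Yᵢ) > 1)` unless the summands are
bounded, so `Xᵢ` is truncated at `q ≤ λ` and `Yᵢ` at `q ≤ 1`. Everything lost is of order `p`:

* Lévy's inequality (`IndepSymm.sum_firstExceed_le`) bounds the probability that some `Yᵢ` is large,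
  hence, by independence, `∑ ℙ(q Yᵢ > 1)` (`IndepSymm.sum_measure_le`), and this controls both the
  large values of the `Xᵢ` and the errors made in the replacement (`IsDominatedBy.integral_trunc_le`,
  `integral_sum_le_of_forall`);
* the truncated sum is an average of two copies of `∑ Yᵢ`, so its tail is at most `2 p`
  (`IndepSymm.measure_sum_trunc_le`);
* a first-exit argument bounds the expected excess of the truncated sum
  (`IndepSymm.integral_excess_le`).

If `16 α⁻¹ m p ≥ 1` there is nothing to prove; otherwise `p < 1 / 16` and the constants add up to
less than `16` (`tail_sum_le_of_seminorm`). A closed convex symmetric set is the intersection of its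
closed thickenings, each of which is the unit ball of a continuous seminorm, its gauge.
-/

/-! ### Independent symmetric families and sign changes -/

section SignFlip

variable {E : Type*} [AddCommGroup E] {n : ℕ}

/-- `signFlip t z` changes the sign of the coordinates of `z` outside `t`. -/
def signFlip (t : Finset (Fin n)) (z : Fin n → E) : Fin n → E :=
  fun i => if i ∈ t then z i else -z i

lemma sum_signFlip_of_subset {s t : Finset (Fin n)} (h : s ⊆ t) (z : Fin n → E) :
    ∑ i ∈ s, signFlip t z i = ∑ i ∈ s, z i :=
  Finset.sum_congr rfl fun i hi => by simp [signFlip, h hi]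

lemma sum_signFlip_of_disjoint {s t : Finset (Fin n)} (h : Disjoint s t) (z : Fin n → E) :
    ∑ i ∈ s, signFlip t z i = -∑ i ∈ s, z i := by
  rw [← Finset.sum_neg_distrib]
  exact Finset.sum_congr rfl fun i hi => by simp [signFlip, Finset.disjoint_left.1 h hi]

lemma sum_univ_signFlip (t : Finset (Fin n)) (z : Fin n → E) :
    ∑ i, signFlip t z i = ∑ i ∈ t, z i - ∑ i ∈ tᶜ, z i := by
  rw [← Finset.sum_add_sum_compl t, sum_signFlip_of_subset subset_rfl,
    sum_signFlip_of_disjoint disjoint_compl_left, sub_eq_add_neg]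

end SignFlip

section Independent

variable {E : Type*} [NormedAddCommGroup E] [MeasurableSpace E]
  {Ω : Type*} [MeasurableSpace Ω] {P : Measure Ω} {n : ℕ} {Z : Fin n → Ω → E}

/-- A finite family of measurable, independent and symmetric random vectors. -/
structure IndepSymm (Z : Fin n → Ω → E) (P : Measure Ω) : Prop where
  meas : ∀ i, Measurable (Z i)
  indep : iIndepFun Z P
  symm : ∀ i, IsSymmetricRV (Z i) P

/-- The law of an independent family is determined by the laws of its members. -/
lemma identDistrib_tuple {F : Type*} [MeasurableSpace F] {Z W : Fin n → Ω → F}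
    (hZm : ∀ i, Measurable (Z i)) (hWm : ∀ i, Measurable (W i))
    (hZ : iIndepFun Z P) (hW : iIndepFun W P)
    (h : ∀ i, IdentDistrib (W i) (Z i) P P) :
    IdentDistrib (fun ω i => W i ω) (fun ω i => Z i ω) P P where
  aemeasurable_fst := (measurable_pi_lambda _ hWm).aemeasurable
  aemeasurable_snd := (measurable_pi_lambda _ hZm).aemeasurable
  map_eq := by
    rw [hZ.map_fun_eq_pi_map fun i => (hZm i).aemeasurable,
      hW.map_fun_eq_pi_map fun i => (hWm i).aemeasurable]
    congr 1
    funext i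
    exact (h i).map_eq

lemma IndepSymm.identDistrib_signFlip [BorelSpace E] (hZ : IndepSymm Z P) (t : Finset (Fin n)) :
    IdentDistrib (fun ω => signFlip t (fun i => Z i ω)) (fun ω i => Z i ω) P P := by
  have hm : ∀ i, Measurable fun x : E => if i ∈ t then x else -x := fun i => by
    split_ifs <;> fun_prop
  refine identDistrib_tuple (W := fun i ω => if i ∈ t then Z i ω else -Z i ω) hZ.meas
    (fun i => (hm i).comp (hZ.meas i)) hZ.indep (hZ.indep.comp _ hm) fun i => ?_
  by_cases hi : i ∈ t
  · simpa [hi] using IdentDistrib.refl (hZ.meas i).aemeasurable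
  · simpa only [hi, if_false] using! hZ.symm i

lemma IndepSymm.comp_odd (hZ : IndepSymm Z P) {f : E → E} (hf : Measurable f)
    (hodd : ∀ x, f (-x) = -f x) : IndepSymm (fun i ω => f (Z i ω)) P where
  meas i := hf.comp (hZ.meas i)
  indep := hZ.indep.comp _ fun _ => hf
  symm i := by
    have := (hZ.symm i).comp hf
    simpa [IsSymmetricRV, Function.comp_def, hodd] using this

lemma IndepSymm.sum_symm [BorelSpace E] [SecondCountableTopology E] (hZ : IndepSymm Z P)
    (s : Finset (Fin n)) :
    IdentDistrib (fun ω => -∑ i ∈ s, Z i ω) (fun ω => ∑ i ∈ s, Z i ω) P P := by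
  have := (hZ.identDistrib_signFlip ∅).comp
    (u := fun z : Fin n → E => ∑ i ∈ s, z i) (by fun_prop)
  simpa [Function.comp_def, sum_signFlip_of_disjoint] using this

end Independent

/-! ### Lévy's inequality -/

section Levy

variable {E : Type*} [NormedAddCommGroup E] [NormedSpace ℝ E] [MeasurableSpace E] [BorelSpace E]
  [SecondCountableTopology E]
  {Ω : Type*} [MeasurableSpace Ω] {P : Measure Ω} {n : ℕ} {Z : Fin n → Ω → E}

/-- The tuples `z` for which `k` is the first index with `q (∑ i ∈ s k, z i) > 1`. -/
def firstExceed (q : Seminorm ℝ E) (s : Fin n → Finset (Fin n)) (k : Fin n) :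
    Set (Fin n → E) :=
  {z | 1 < q (∑ i ∈ s k, z i) ∧ ∀ j < k, q (∑ i ∈ s j, z i) ≤ 1}

omit [MeasurableSpace E] [BorelSpace E] [SecondCountableTopology E] in
lemma exists_firstExceed (q : Seminorm ℝ E) (s : Fin n → Finset (Fin n)) {z : Fin n → E}
    (h : ∃ k, 1 < q (∑ i ∈ s k, z i)) : ∃ k, z ∈ firstExceed q s k := by
  obtain ⟨k, hk, hmin⟩ := WellFounded.has_min (wellFounded_lt (α := Fin n))
    {k | 1 < q (∑ i ∈ s k, z i)} h
  exact ⟨k, hk, fun j hj => not_lt.1 fun hj' => hmin j hj' hj⟩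

omit [MeasurableSpace E] [BorelSpace E] [SecondCountableTopology E] in
lemma pairwise_disjoint_firstExceed (q : Seminorm ℝ E) (s : Fin n → Finset (Fin n)) :
    Pairwise (Function.onFun Disjoint (firstExceed q s)) := by
  intro j k hjk
  refine Set.disjoint_left.2 fun z hj hk => ?_
  rcases lt_or_gt_of_ne hjk with h | h
  · exact absurd hj.1 (not_lt.2 (hk.2 j h))
  · exact absurd hk.1 (not_lt.2 (hj.2 k h))

lemma measurableSet_firstExceed {q : Seminorm ℝ E} (hq : Continuous q)
    (s : Fin n → Finset (Fin n)) (k : Fin n) : MeasurableSet (firstExceed q s k) := by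
  have hm : ∀ j, Measurable fun z : Fin n → E => q (∑ i ∈ s j, z i) := fun j =>
    hq.measurable.comp (by fun_prop)
  refine (measurableSet_lt measurable_const (hm k)).inter ?_
  have : {z : Fin n → E | ∀ j < k, q (∑ i ∈ s j, z i) ≤ 1}
      = ⋂ j, ⋂ _ : j < k, {z | q (∑ i ∈ s j, z i) ≤ 1} := by ext; simp
  change MeasurableSet {z : Fin n → E | ∀ j < k, q (∑ i ∈ s j, z i) ≤ 1}
  rw [this]
  exact MeasurableSet.iInter fun j => MeasurableSet.iInter fun _ =>
    measurableSet_le (hm j) measurable_const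

lemma sum_firstExceed_inter_le [IsFiniteMeasure P] (hZ : ∀ i, Measurable (Z i))
    {q : Seminorm ℝ E} (hq : Continuous q) (s : Fin n → Finset (Fin n)) {A : Set Ω}
    (hA : MeasurableSet A) :
    ∑ k, P.real ({ω | (fun i => Z i ω) ∈ firstExceed q s k} ∩ A) ≤ P.real A := by
  have hZ' : Measurable fun ω i => Z i ω := measurable_pi_lambda _ hZ
  have hmeas : ∀ k, MeasurableSet ({ω | (fun i => Z i ω) ∈ firstExceed q s k} ∩ A) := fun k =>
    (hZ' (measurableSet_firstExceed hq s k)).inter hA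
  rw [← measureReal_iUnion_fintype (fun j k hjk => ?_) hmeas]
  · exact measureReal_mono (Set.iUnion_subset fun k => Set.inter_subset_right)
  · refine Set.disjoint_left.2 fun ω hj hk => ?_
    exact Set.disjoint_left.1 (pairwise_disjoint_firstExceed q s hjk) hj.1 hk.1

/-- **Lévy's inequality**, for the partial sums over a family of index sets `s k` such that each
earlier set is contained in, or disjoint from, each later one. Both the sets `{k}` and the initial
segments qualify. -/
lemma IndepSymm.sum_firstExceed_le [IsFiniteMeasure P] (hZ : IndepSymm Z P)
    {q : Seminorm ℝ E} (hq : Continuous q) (s : Fin n → Finset (Fin n))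
    (hs : ∀ j k, j ≤ k → s j ⊆ s k ∨ Disjoint (s j) (s k)) :
    ∑ k, P.real {ω | (fun i => Z i ω) ∈ firstExceed q s k}
      ≤ 2 * P.real {ω | 1 < q (∑ i, Z i ω)} := by
  have hS : Measurable fun z : Fin n → E => q (∑ i, z i) := hq.measurable.comp (by fun_prop)
  have hZ' : Measurable fun ω i => Z i ω := measurable_pi_lambda _ hZ.meas
  have hA : MeasurableSet {z : Fin n → E | 1 < q (∑ i, z i)} :=
    measurableSet_lt measurable_const hS
  have key : ∀ k, P.real {ω | (fun i => Z i ω) ∈ firstExceed q s k}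
      ≤ 2 * P.real ({ω | (fun i => Z i ω) ∈ firstExceed q s k} ∩ {ω | 1 < q (∑ i, Z i ω)}) := by
    intro k
    have hinv : ∀ z : Fin n → E, signFlip (s k) z ∈ firstExceed q s k ↔ z ∈ firstExceed q s k := by
      intro z
      have hqj : ∀ j ≤ k, q (∑ i ∈ s j, signFlip (s k) z i) = q (∑ i ∈ s j, z i) := by
        intro j hj
        rcases hs j k hj with h | h
        · rw [sum_signFlip_of_subset h]
        · rw [sum_signFlip_of_disjoint h, map_neg_eq_map]
      simp only [firstExceed, Set.mem_ofPred_eq, hqj k le_rfl]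
      exact and_congr_right fun _ => forall₂_congr fun j hj => by rw [hqj j hj.le]
    have hflip := (hZ.identDistrib_signFlip (s k)).measure_mem_eq
      ((measurableSet_firstExceed hq s k).inter hA)
    have hreal : P.real {ω | signFlip (s k) (fun i => Z i ω) ∈
          firstExceed q s k ∩ {z | 1 < q (∑ i, z i)}}
        = P.real ({ω | (fun i => Z i ω) ∈ firstExceed q s k} ∩ {ω | 1 < q (∑ i, Z i ω)}) :=
      congrArg ENNReal.toReal hflip
    calc _ ≤ P.real (({ω | (fun i => Z i ω) ∈ firstExceed q s k} ∩ {ω | 1 < q (∑ i, Z i ω)}) ∪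
            {ω | signFlip (s k) (fun i => Z i ω) ∈ firstExceed q s k ∩ {z | 1 < q (∑ i, z i)}}) := by
          refine measureReal_mono fun ω hω => ?_
          by_contra hcon
          simp only [Set.mem_union, Set.mem_inter_iff, Set.mem_ofPred_eq, hinv, not_or, not_and,
            not_lt] at hcon hω
          have h1 := hcon.1 hω
          have h2 := hcon.2 hω
          rw [sum_univ_signFlip] at h2
          rw [← Finset.sum_add_sum_compl (s k)] at h1
          -- `2 a = (a + b) + (a - b)`, so one of the two sums leaves the unit ball with `a`.
          have h3 := map_add_le_add q (∑ i ∈ s k, Z i ω + ∑ i ∈ (s k)ᶜ, Z i ω)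
            (∑ i ∈ s k, Z i ω - ∑ i ∈ (s k)ᶜ, Z i ω)
          rw [add_add_sub_cancel, ← two_smul ℝ, map_smul_eq_mul] at h3
          have := hω.1
          norm_num at h3
          linarith
      _ ≤ _ := by
          refine (measureReal_union_le _ _).trans ?_
          rw [hreal, two_mul]
  refine (Finset.sum_le_sum fun k _ => key k).trans ?_
  rw [← Finset.mul_sum]
  have := sum_firstExceed_inter_le (P := P) hZ.meas hq s (hZ' hA)
  exact mul_le_mul_of_nonneg_left this zero_le_two

/-- A small sum forces small terms: the case of the index sets `{k}` in Lévy's inequality. -/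
lemma IndepSymm.measure_exists_le [IsFiniteMeasure P] (hZ : IndepSymm Z P)
    {q : Seminorm ℝ E} (hq : Continuous q) :
    P.real {ω | ∃ i, 1 < q (Z i ω)} ≤ 2 * P.real {ω | 1 < q (∑ i, Z i ω)} := by
  refine le_trans ?_ (hZ.sum_firstExceed_le hq (fun k => {k}) fun j k _ => ?_)
  · calc P.real {ω | ∃ i, 1 < q (Z i ω)}
        ≤ P.real (⋃ k, {ω | (fun i => Z i ω) ∈ firstExceed q (fun k => {k}) k}) := by
          refine measureReal_mono (μ := P) fun ω hω => ?_
          obtain ⟨k, hk⟩ := exists_firstExceed q (fun k => {k}) (z := fun i => Z i ω)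
            (by simpa using hω)
          exact Set.mem_iUnion.2 ⟨k, hk⟩
      _ ≤ _ := measureReal_iUnion_fintype_le (μ := P) _
  · by_cases h : j = k
    · simp [h]
    · simp [h]

lemma one_add_sum_le_prod_one_add {ι : Type*} (s : Finset ι) {a : ι → ℝ}
    (ha : ∀ i ∈ s, 0 ≤ a i) : 1 + ∑ i ∈ s, a i ≤ ∏ i ∈ s, (1 + a i) := by
  classical
  induction s using Finset.induction_on with
  | empty => simp
  | insert j s hj ih =>
    rw [Finset.sum_insert hj, Finset.prod_insert hj]
    have h1 := ih fun i hi => ha i (Finset.mem_insert_of_mem hi)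
    have h2 := ha j (Finset.mem_insert_self j s)
    have h3 : 0 ≤ ∑ i ∈ s, a i :=
      Finset.sum_nonneg fun i hi => ha i (Finset.mem_insert_of_mem hi)
    nlinarith

/-- If the sum rarely leaves the unit ball of `q`, then the terms do so with a small total
probability. -/
lemma IndepSymm.sum_measure_le [IsProbabilityMeasure P] (hZ : IndepSymm Z P)
    {q : Seminorm ℝ E} (hq : Continuous q) {p : ℝ} (hp : P.real {ω | 1 < q (∑ i, Z i ω)} ≤ p)
    (hp2 : p < 1 / 2) :
    ∑ i, P.real {ω | 1 < q (Z i ω)} ≤ 2 * p / (1 - 2 * p) := by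
  have hm : MeasurableSet {x : E | 1 < q x} := measurableSet_lt measurable_const hq.measurable
  have hprod : ∏ i, (1 - P.real {ω | 1 < q (Z i ω)}) = P.real {ω | ¬ ∃ i, 1 < q (Z i ω)} := by
    have h := hZ.indep.measure_inter_preimage_eq_mul Finset.univ
      (sets := fun _ => {x : E | 1 < q x}ᶜ) (fun i _ => hm.compl)
    have h2 : {ω | ¬ ∃ i, 1 < q (Z i ω)} = ⋂ i ∈ Finset.univ, Z i ⁻¹' {x : E | 1 < q x}ᶜ := by
      ext; simp
    rw [h2, measureReal_def, h, ENNReal.toReal_prod]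
    refine Finset.prod_congr rfl fun i _ => ?_
    rw [Set.preimage_compl]
    exact (probReal_compl_eq_one_sub (hZ.meas i hm)).symm
  have hmE : MeasurableSet {ω | ∃ i, 1 < q (Z i ω)} := by
    rw [Set.ofPred_exists]
    exact MeasurableSet.iUnion fun i => hZ.meas i hm
  have hcompl : P.real {ω | ¬ ∃ i, 1 < q (Z i ω)} = 1 - P.real {ω | ∃ i, 1 < q (Z i ω)} :=
    probReal_compl_eq_one_sub hmE
  have hmax := hZ.measure_exists_le hq
  have hlow : 1 - 2 * p ≤ ∏ i, (1 - P.real {ω | 1 < q (Z i ω)}) := by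
    rw [hprod, hcompl]; linarith
  -- `(1 - aᵢ)(1 + aᵢ) ≤ 1`, and `∏ (1 + aᵢ) ≥ 1 + ∑ aᵢ`.
  have hone : (∏ i, (1 - P.real {ω | 1 < q (Z i ω)})) *
      (1 + ∑ i, P.real {ω | 1 < q (Z i ω)}) ≤ 1 := by
    calc _ ≤ (∏ i, (1 - P.real {ω | 1 < q (Z i ω)})) *
        ∏ i, (1 + P.real {ω | 1 < q (Z i ω)}) := by
          refine mul_le_mul_of_nonneg_left ?_ (by rw [hprod]; positivity)
          exact one_add_sum_le_prod_one_add _ fun i _ => measureReal_nonneg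
      _ ≤ 1 := by
          rw [← Finset.prod_mul_distrib]
          refine Finset.prod_le_one (fun i _ => ?_) fun i _ => ?_
          · have := measureReal_nonneg (μ := P) (s := {ω | 1 < q (Z i ω)})
            have := measureReal_le_one (μ := P) (s := {ω | 1 < q (Z i ω)})
            nlinarith
          · nlinarith [sq_nonneg (P.real {ω | 1 < q (Z i ω)})]
  have hpos : 0 < 1 - 2 * p := by linarith
  have hsum : 0 ≤ ∑ i, P.real {ω | 1 < q (Z i ω)} :=
    Finset.sum_nonneg fun i _ => measureReal_nonneg
  rw [le_div_iff₀ hpos]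
  nlinarith

end Levy

/-! ### Truncation and the expected excess of a bounded sum -/

section Trunc

variable {E : Type*} [NormedAddCommGroup E] [NormedSpace ℝ E]

open Classical in
/-- The vector `x` if it lies in the closed ball of radius `r` for `q`, and `0` otherwise. -/
noncomputable def trunc (q : Seminorm ℝ E) (r : ℝ) (x : E) : E := if q x ≤ r then x else 0

lemma trunc_of_le {q : Seminorm ℝ E} {r : ℝ} {x : E} (h : q x ≤ r) : trunc q r x = x := if_pos h

lemma trunc_of_lt {q : Seminorm ℝ E} {r : ℝ} {x : E} (h : r < q x) : trunc q r x = 0 :=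
  if_neg h.not_ge

lemma seminorm_trunc_le (q : Seminorm ℝ E) {r : ℝ} (hr : 0 ≤ r) (x : E) :
    q (trunc q r x) ≤ r := by
  rcases le_or_gt (q x) r with h | h
  · rwa [trunc_of_le h]
  · rwa [trunc_of_lt h, map_zero]

lemma trunc_neg (q : Seminorm ℝ E) (r : ℝ) (x : E) : trunc q r (-x) = -trunc q r x := by
  rcases le_or_gt (q x) r with h | h
  · rw [trunc_of_le h, trunc_of_le (by rwa [map_neg_eq_map])]
  · rw [trunc_of_lt h, trunc_of_lt (by rwa [map_neg_eq_map]), neg_zero]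

variable [MeasurableSpace E] [BorelSpace E]

lemma measurable_trunc {q : Seminorm ℝ E} (hq : Continuous q) (r : ℝ) :
    Measurable (trunc q r) :=
  Measurable.ite (measurableSet_le hq.measurable measurable_const) measurable_id measurable_const

variable {Ω : Type*} [MeasurableSpace Ω] {P : Measure Ω} {n : ℕ} {Z : Fin n → Ω → E}

lemma IndepSymm.comp_trunc (hZ : IndepSymm Z P) {q : Seminorm ℝ E} (hq : Continuous q) (r : ℝ) :
    IndepSymm (fun i ω => trunc q r (Z i ω)) P :=
  hZ.comp_odd (measurable_trunc hq r) (trunc_neg q r)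

open Classical in
/-- Reflecting a symmetric vector where it is large does not change its law. -/
lemma identDistrib_reflect {Y : Ω → E} (hYm : Measurable Y) (hY : IsSymmetricRV Y P)
    {q : Seminorm ℝ E} (hq : Continuous q) :
    IdentDistrib (fun ω => if q (Y ω) ≤ 1 then Y ω else -Y ω) Y P P := by
  have hK : MeasurableSet {x : E | q x ≤ 1} := measurableSet_le hq.measurable measurable_const
  have hρ : Measurable fun x : E => if q x ≤ 1 then x else -x :=
    Measurable.ite hK measurable_id measurable_neg
  refine ⟨(hρ.comp hYm).aemeasurable, hYm.aemeasurable, Measure.ext fun A hA => ?_⟩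
  change Measure.map ((fun x : E => if q x ≤ 1 then x else -x) ∘ Y) P A = _
  rw [Measure.map_apply (hρ.comp hYm) hA, Measure.map_apply hYm hA]
  rw [← measure_inter_add_sdiff ((fun x : E => if q x ≤ 1 then x else -x) ∘ Y ⁻¹' A) (hYm hK),
    ← measure_inter_add_sdiff (Y ⁻¹' A) (hYm hK)]
  congr 1
  · congr 1
    ext ω
    simp only [Set.mem_inter_iff, Set.mem_preimage, Function.comp_apply, Set.mem_ofPred_eq]
    exact and_congr_left fun h => by rw [if_pos h]
  · have h := hY.measure_mem_eq (hA.diff hK)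
    rw [← Set.preimage_sdiff, ← h]
    congr 1
    ext ω
    simp only [Set.mem_sdiff, Set.mem_preimage, Function.comp_apply, Set.mem_ofPred_eq,
      map_neg_eq_map]
    exact and_congr_left fun h => by rw [if_neg h]

variable [SecondCountableTopology E]

/-- Truncation at most doubles the tail of the sum, since the truncated sum is the average of the
sum and a copy of it with the same law. -/
lemma IndepSymm.measure_sum_trunc_le [IsFiniteMeasure P] (hZ : IndepSymm Z P)
    {q : Seminorm ℝ E} (hq : Continuous q) :
    P.real {ω | 1 < q (∑ i, trunc q 1 (Z i ω))} ≤ 2 * P.real {ω | 1 < q (∑ i, Z i ω)} := by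
  classical
  have hK : MeasurableSet {x : E | q x ≤ 1} := measurableSet_le hq.measurable measurable_const
  have hρ : Measurable fun x : E => if q x ≤ 1 then x else -x :=
    Measurable.ite hK measurable_id measurable_neg
  have hA : MeasurableSet {z : Fin n → E | 1 < q (∑ i, z i)} :=
    measurableSet_lt measurable_const (hq.measurable.comp (by fun_prop))
  have hid := identDistrib_tuple (W := fun i ω => if q (Z i ω) ≤ 1 then Z i ω else -Z i ω)
    hZ.meas (fun i => hρ.comp (hZ.meas i)) hZ.indep (hZ.indep.comp _ fun _ => hρ)
    fun i => identDistrib_reflect (hZ.meas i) (hZ.symm i) hq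
  have hreal : P.real {ω | 1 < q (∑ i, if q (Z i ω) ≤ 1 then Z i ω else -Z i ω)}
      = P.real {ω | 1 < q (∑ i, Z i ω)} := congrArg ENNReal.toReal (hid.measure_mem_eq hA)
  calc _ ≤ P.real ({ω | 1 < q (∑ i, Z i ω)} ∪
        {ω | 1 < q (∑ i, if q (Z i ω) ≤ 1 then Z i ω else -Z i ω)}) := by
        refine measureReal_mono (μ := P) fun ω hω => ?_
        by_contra hcon
        simp only [Set.mem_union, Set.mem_ofPred_eq, not_or, not_lt] at hcon hω
        have h3 := map_add_le_add q (∑ i, Z i ω) (∑ i, if q (Z i ω) ≤ 1 then Z i ω else -Z i ω)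
        rw [← Finset.sum_add_distrib, Finset.sum_congr rfl
          (g := fun i => (2 : ℝ) • trunc q 1 (Z i ω)) fun i _ => ?_,
          ← Finset.smul_sum, map_smul_eq_mul] at h3
        · norm_num at h3
          linarith [hcon.1, hcon.2]
        · split_ifs with h
          · rw [trunc_of_le h, two_smul]
          · rw [trunc_of_lt (not_le.1 h), smul_zero, add_neg_cancel]
    _ ≤ _ := by
        refine (measureReal_union_le _ _).trans ?_
        rw [hreal, two_mul]

omit [MeasurableSpace E] [BorelSpace E] [SecondCountableTopology E] [MeasurableSpace Ω] in
lemma seminorm_sum_le {q : Seminorm ℝ E} {r : ℝ} (hb : ∀ i ω, q (Z i ω) ≤ r)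
    (s : Finset (Fin n)) (ω : Ω) : q (∑ i ∈ s, Z i ω) ≤ s.card * r := by
  refine (Finset.le_sum_of_subadditive q (map_zero q).le (map_add_le_add q) s
    fun i => Z i ω).trans ?_
  rw [← nsmul_eq_mul]
  exact Finset.sum_le_card_nsmul _ _ _ fun i _ => hb i ω

lemma integrable_seminorm_sum [IsFiniteMeasure P] (hZ : ∀ i, Measurable (Z i))
    {q : Seminorm ℝ E} (hq : Continuous q) {r : ℝ} (hb : ∀ i ω, q (Z i ω) ≤ r)
    (s : Finset (Fin n)) : Integrable (fun ω => q (∑ i ∈ s, Z i ω)) P := by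
  refine Integrable.of_bound (C := s.card * r)
    (hq.measurable.comp (by fun_prop)).aestronglyMeasurable
    (ae_of_all _ fun ω => ?_)
  rw [Real.norm_of_nonneg (apply_nonneg q _)]
  exact seminorm_sum_le hb s ω

/-- For independent symmetric vectors, partial sums have a smaller expected seminorm. -/
lemma IndepSymm.integral_sum_le [IsFiniteMeasure P] (hZ : IndepSymm Z P)
    {q : Seminorm ℝ E} (hq : Continuous q) {r : ℝ} (hb : ∀ i ω, q (Z i ω) ≤ r)
    (t : Finset (Fin n)) :
    ∫ ω, q (∑ i ∈ t, Z i ω) ∂P ≤ ∫ ω, q (∑ i, Z i ω) ∂P := by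
  have hm : Measurable fun z : Fin n → E => q (∑ i, z i) := hq.measurable.comp (by fun_prop)
  have hid := (hZ.identDistrib_signFlip t).comp hm
  have hint := integrable_seminorm_sum hZ.meas hq hb (P := P) Finset.univ
  have hint' : Integrable (fun ω => q (∑ i, signFlip t (fun i => Z i ω) i)) P :=
    hid.integrable_iff.2 hint
  have heq : ∫ ω, q (∑ i, signFlip t (fun i => Z i ω) i) ∂P = ∫ ω, q (∑ i, Z i ω) ∂P :=
    hid.integral_eq
  have hmono : ∫ ω, 2 * q (∑ i ∈ t, Z i ω) ∂P
      ≤ ∫ ω, (q (∑ i, Z i ω) + q (∑ i, signFlip t (fun i => Z i ω) i)) ∂P := by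
    refine integral_mono ((integrable_seminorm_sum hZ.meas hq hb t).const_mul 2)
      (hint.add hint') fun ω => ?_
    have h3 := map_add_le_add q (∑ i ∈ t, Z i ω + ∑ i ∈ tᶜ, Z i ω)
      (∑ i ∈ t, Z i ω - ∑ i ∈ tᶜ, Z i ω)
    rw [add_add_sub_cancel, ← two_smul ℝ, map_smul_eq_mul, ← sum_univ_signFlip,
      Finset.sum_add_sum_compl] at h3
    simpa using h3
  rw [integral_add hint hint', heq, integral_const_mul] at hmono
  linarith

/-- The tuple `z` with the coordinates outside `t` replaced by `0`. -/
def mask (t : Finset (Fin n)) (z : Fin n → E) : Fin n → E := fun i => if i ∈ t then z i else 0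

omit [NormedSpace ℝ E] [SecondCountableTopology E] [BorelSpace E] in
lemma indepFun_mask (hZm : ∀ i, Measurable (Z i)) (hZ : iIndepFun Z P) (t : Finset (Fin n)) :
    IndepFun (fun ω => mask t (fun i => Z i ω)) (fun ω => mask tᶜ (fun i => Z i ω)) P := by
  have hext : ∀ u : Finset (Fin n), Measurable fun (z : u → E) (i : Fin n) =>
      if h : i ∈ u then z ⟨i, h⟩ else 0 := fun u => by
    refine measurable_pi_lambda _ fun i => ?_
    by_cases h : i ∈ u
    · simpa [h] using measurable_pi_apply _
    · simp [h]
  have := (hZ.indepFun_finset t tᶜ disjoint_compl_right hZm).comp (hext t) (hext tᶜ)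
  have hmask : ∀ u : Finset (Fin n), (fun ω => mask u (fun i => Z i ω)) =
      (fun (z : u → E) (i : Fin n) => if h : i ∈ u then z ⟨i, h⟩ else 0) ∘
        fun ω (i : u) => Z i ω := fun u => by
    funext ω i
    simp [mask]
  rwa [hmask, hmask]

/-- A Hoffmann-Jørgensen type estimate: if the terms stay in the unit ball of `q` and the sum
leaves it with small probability, then the expected excess of the sum over the ball is of the
order of that probability. At the first exit the partial sum is still in the ball of radius `2`,
and the remaining increment is independent of the past. -/
lemma IndepSymm.integral_excess_le [IsProbabilityMeasure P] (hZ : IndepSymm Z P)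
    {q : Seminorm ℝ E} (hq : Continuous q) (hb : ∀ i ω, q (Z i ω) ≤ 1) {p : ℝ}
    (hp : P.real {ω | 1 < q (∑ i, Z i ω)} ≤ p) (hp2 : p < 1 / 2) :
    ∫ ω, max (q (∑ i, Z i ω) - 1) 0 ∂P ≤ 4 * p / (1 - 2 * p) := by
  set s : Fin n → Finset (Fin n) := fun k => Finset.Iic k with hs
  set B : Fin n → Set Ω := fun k => {ω | (fun i => Z i ω) ∈ firstExceed q s k} with hB
  set M : ℝ := ∫ ω, max (q (∑ i, Z i ω) - 1) 0 ∂P with hM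
  have hZ' : Measurable fun ω i => Z i ω := measurable_pi_lambda _ hZ.meas
  have hBm : ∀ k, MeasurableSet (B k) := fun k => hZ' (measurableSet_firstExceed hq s k)
  have hint : ∀ t : Finset (Fin n), Integrable (fun ω => q (∑ i ∈ t, Z i ω)) P := fun t =>
    integrable_seminorm_sum hZ.meas hq hb t
  have hintM : Integrable (fun ω => max (q (∑ i, Z i ω) - 1) 0) P :=
    ((hint _).sub (integrable_const 1)).sup (integrable_const 0)
  have hqM : ∫ ω, q (∑ i, Z i ω) ∂P ≤ 1 + M := by
    have : ∫ ω, q (∑ i, Z i ω) ∂P ≤ ∫ ω, (1 + max (q (∑ i, Z i ω) - 1) 0) ∂P :=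
      integral_mono (hint _) ((integrable_const 1).add hintM) fun ω => by
        have := le_max_left (q (∑ i, Z i ω) - 1) 0
        simp only
        linarith
    rw [integral_add (integrable_const 1) hintM] at this
    simpa using this
  have hpast : ∀ k ω, ω ∈ B k → q (∑ i ∈ s k, Z i ω) ≤ 2 := by
    intro k ω hω
    have hstep : s k = insert k (Finset.Iio k) := by
      ext i; simp [s, le_iff_eq_or_lt]
    rw [hstep, Finset.sum_insert (by simp)]
    have h1 := map_add_le_add q (Z k ω) (∑ i ∈ Finset.Iio k, Z i ω)
    have h2 : q (∑ i ∈ Finset.Iio k, Z i ω) ≤ 1 := by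
      by_cases hk : k.val = 0
      · have : Finset.Iio k = ∅ := by
          ext i; simp [Fin.lt_def, hk]
        simp [this]
      · have : Finset.Iio k = s ⟨k.val - 1, by omega⟩ := by
          ext i; simp only [s, Finset.mem_Iio, Finset.mem_Iic, Fin.lt_def, Fin.le_def]; omega
        rw [this]
        exact hω.2 _ (by rw [Fin.lt_def]; simp only; omega)
    linarith [hb k ω]
  have hintB : ∀ k, Integrable
      ((B k).indicator fun ω => 1 + q (∑ i ∈ (s k)ᶜ, Z i ω)) P := fun k =>
    ((integrable_const 1).add (hint _)).indicator (hBm k)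
  have hpt : ∀ ω, max (q (∑ i, Z i ω) - 1) 0
      ≤ ∑ k, (B k).indicator (fun ω => 1 + q (∑ i ∈ (s k)ᶜ, Z i ω)) ω := by
    intro ω
    have hnn : ∀ k, 0 ≤ (B k).indicator (fun ω => 1 + q (∑ i ∈ (s k)ᶜ, Z i ω)) ω := fun k =>
      Set.indicator_nonneg (fun ω _ => add_nonneg zero_le_one (apply_nonneg q _)) ω
    refine max_le ?_ (Finset.sum_nonneg fun k _ => hnn k)
    rcases le_or_gt (q (∑ i, Z i ω)) 1 with h | h
    · linarith [Finset.sum_nonneg fun k (_ : k ∈ Finset.univ) => hnn k]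
    · have hn : 0 < n := by
        rcases Nat.eq_zero_or_pos n with rfl | h'
        · simp at h
          linarith
        · exact h'
      have hlast : s ⟨n - 1, by omega⟩ = Finset.univ := by
        ext i; simp only [s, Finset.mem_Iic, Fin.le_def, Finset.mem_univ, iff_true]; omega
      obtain ⟨k, hk⟩ := exists_firstExceed q s (z := fun i => Z i ω)
        ⟨⟨n - 1, by omega⟩, by rw [hlast]; exact h⟩
      refine le_trans ?_ (Finset.single_le_sum (fun k _ => hnn k) (Finset.mem_univ k))
      rw [Set.indicator_of_mem (show ω ∈ B k from hk)]
      have h1 := map_add_le_add q (∑ i ∈ s k, Z i ω) (∑ i ∈ (s k)ᶜ, Z i ω)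
      rw [Finset.sum_add_sum_compl] at h1
      linarith [hpast k ω hk]
  have hterm : ∀ k, ∫ ω, (B k).indicator (fun ω => 1 + q (∑ i ∈ (s k)ᶜ, Z i ω)) ω ∂P
      ≤ P.real (B k) * (2 + M) := by
    intro k
    have hfut : ∀ ω, ∑ i ∈ (s k)ᶜ, Z i ω = ∑ i, mask (s k)ᶜ (fun i => Z i ω) i := fun ω => by
      simp only [mask, Finset.sum_ite_mem, Finset.univ_inter]
    have hpastset : ∀ z : Fin n → E, mask (s k) z ∈ firstExceed q s k ↔ z ∈ firstExceed q s k := by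
      intro z
      have hqj : ∀ j ≤ k, ∑ i ∈ s j, mask (s k) z i = ∑ i ∈ s j, z i := fun j hj =>
        Finset.sum_congr rfl fun i hi => by
          have : i ∈ s k := Finset.mem_Iic.2 ((Finset.mem_Iic.1 hi).trans hj)
          simp [mask, this]
      simp only [firstExceed, Set.mem_ofPred_eq, hqj k le_rfl]
      exact and_congr_right fun _ => forall₂_congr fun j hj => by rw [hqj j hj.le]
    have hind : IndepFun ((B k).indicator fun _ => (1 : ℝ))
        (fun ω => 1 + q (∑ i ∈ (s k)ᶜ, Z i ω)) P := by
      have hφ : Measurable ((firstExceed q s k).indicator fun _ => (1 : ℝ)) :=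
        measurable_const.indicator (measurableSet_firstExceed hq s k)
      have h := (indepFun_mask hZ.meas hZ.indep (s k)).comp
        (ψ := fun z : Fin n → E => 1 + q (∑ i, z i)) hφ
        ((hq.measurable.comp (by fun_prop)).const_add 1)
      convert h using 1
      · funext ω
        by_cases hω : (fun i => Z i ω) ∈ firstExceed q s k
        · rw [Set.indicator_of_mem (show ω ∈ B k from hω), Function.comp_apply,
            Set.indicator_of_mem ((hpastset _).2 hω)]
        · rw [Set.indicator_of_notMem (show ω ∉ B k from hω), Function.comp_apply,
            Set.indicator_of_notMem (mt (hpastset _).1 hω)]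
      · funext ω
        simp only [hfut ω, Function.comp_apply]
    have hprod : ∀ ω, (B k).indicator (fun ω => 1 + q (∑ i ∈ (s k)ᶜ, Z i ω)) ω
        = (B k).indicator (fun _ => (1 : ℝ)) ω * (1 + q (∑ i ∈ (s k)ᶜ, Z i ω)) := fun ω => by
      by_cases hω : ω ∈ B k <;> simp [hω]
    rw [integral_congr_ae (ae_of_all _ hprod), hind.integral_fun_mul_eq_mul_integral
      ((measurable_const.indicator (hBm k)).aestronglyMeasurable)
      ((integrable_const 1).add (hint _)).aestronglyMeasurable,
      integral_indicator_const _ (hBm k), integral_add (integrable_const 1) (hint _)]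
    have := hZ.integral_sum_le hq hb (s k)ᶜ
    simp only [smul_eq_mul, mul_one, integral_const, probReal_univ]
    refine mul_le_mul_of_nonneg_left ?_ measureReal_nonneg
    linarith
  have hM0 : 0 ≤ M := integral_nonneg fun ω => le_max_right _ _
  have hmain : M ≤ 2 * p * (2 + M) := by
    calc M ≤ ∫ ω, ∑ k, (B k).indicator (fun ω => 1 + q (∑ i ∈ (s k)ᶜ, Z i ω)) ω ∂P :=
          integral_mono hintM (integrable_finsetSum _ fun k _ => hintB k) hpt
      _ = ∑ k, ∫ ω, (B k).indicator (fun ω => 1 + q (∑ i ∈ (s k)ᶜ, Z i ω)) ω ∂P :=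
          integral_finsetSum _ fun k _ => hintB k
      _ ≤ ∑ k, P.real (B k) * (2 + M) := Finset.sum_le_sum fun k _ => hterm k
      _ = (∑ k, P.real (B k)) * (2 + M) := by rw [Finset.sum_mul]
      _ ≤ 2 * p * (2 + M) := by
          refine mul_le_mul_of_nonneg_right ?_ (by linarith)
          refine (hZ.sum_firstExceed_le hq s fun j k hjk => Or.inl ?_).trans (by linarith)
          exact Finset.Iic_subset_Iic.2 hjk
  rw [le_div_iff₀ (by linarith)]
  linarith

end Trunc

/-! ### Domination and expectations of convex functions -/

section Convex

variable {E : Type*} [NormedAddCommGroup E] [NormedSpace ℝ E]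

/-- An even convex function that is `1`-Lipschitz for the seminorm `q`. -/
structure IsEvenConvexLip (q : Seminorm ℝ E) (φ : E → ℝ) : Prop where
  convex : ConvexOn ℝ Set.univ φ
  even : ∀ x, φ (-x) = φ x
  lip : ∀ x y, φ (x + y) ≤ φ x + q y

variable {q : Seminorm ℝ E} {φ : E → ℝ}

lemma IsEvenConvexLip.abs_sub_le (h : IsEvenConvexLip q φ) (x y : E) :
    |φ x - φ y| ≤ q (x - y) := by
  have h1 := h.lip y (x - y)
  have h2 := h.lip x (y - x)
  rw [add_sub_cancel] at h1 h2
  rw [map_sub_rev] at h2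
  rw [abs_le]
  constructor <;> linarith

lemma IsEvenConvexLip.abs_le (h : IsEvenConvexLip q φ) (x : E) : |φ x| ≤ |φ 0| + q x := by
  have h1 := h.abs_sub_le x 0
  have h2 := abs_sub_abs_le_abs_sub (φ x) (φ 0)
  rw [sub_zero] at h1
  linarith

lemma IsEvenConvexLip.continuous (h : IsEvenConvexLip q φ) (hq : Continuous q) :
    Continuous φ := by
  refine continuous_iff_continuousAt.2 fun x => ?_
  rw [ContinuousAt, tendsto_iff_norm_sub_tendsto_zero]
  have h0 : Filter.Tendsto (fun y => q (y - x)) (nhds x) (nhds 0) := by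
    have : Continuous fun y => q (y - x) := by fun_prop
    simpa using this.tendsto x
  exact squeeze_zero (fun _ => norm_nonneg _) (fun y => h.abs_sub_le y x) h0

lemma IsEvenConvexLip.zero_le (h : IsEvenConvexLip q φ) (x : E) : φ 0 ≤ φ x := by
  have h1 := h.convex.2 (Set.mem_univ x) (Set.mem_univ (-x))
    (show (0 : ℝ) ≤ 1 / 2 by norm_num) (show (0 : ℝ) ≤ 1 / 2 by norm_num) (by norm_num)
  rw [h.even, smul_neg, add_neg_cancel, smul_eq_mul] at h1
  linarith

lemma isEvenConvexLip_excess (q : Seminorm ℝ E) (c : ℝ) :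
    IsEvenConvexLip q fun x => max (q x - c) 0 where
  convex := by
    have h := q.convexOn.sub (concaveOn_const c convex_univ)
    exact h.sup (convexOn_const 0 convex_univ)
  even x := by simp
  lip x y := by
    have h1 := map_add_le_add q x y
    have h2 := apply_nonneg q y
    refine max_le ?_ ?_
    · linarith [le_max_left (q x - c) 0]
    · linarith [le_max_right (q x - c) 0]

variable [MeasurableSpace E] [BorelSpace E]
  {Ω Ω' : Type*} [MeasurableSpace Ω] [MeasurableSpace Ω'] {μ : Measure Ω} {ν : Measure Ω'}

/-- Domination passes from indicators to expectations of functions with closed convex symmetric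
sublevel sets, by the layer cake formula. -/
lemma IsDominatedBy.integral_le [IsFiniteMeasure μ] [IsFiniteMeasure ν] {κ lam : ℝ} (hκ : 0 ≤ κ)
    {X : Ω → E} {Y : Ω' → E} (hX : Measurable X) (hY : Measurable Y)
    (hdom : IsDominatedBy κ lam X μ Y ν) {h : E → ℝ} {C : ℝ} (h0 : ∀ x, 0 ≤ h x)
    (hC : ∀ x, h x ≤ C)
    (hlev : ∀ t, IsClosed {x | h x ≤ t} ∧ Convex ℝ {x | h x ≤ t} ∧ ∀ x, h (-x) = h x) :
    ∫ ω, h (X ω) ∂μ ≤ κ * ∫ ω, h (lam • Y ω) ∂ν := by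
  have hm : Measurable h := measurable_of_Iic fun t => (hlev t).1.measurableSet
  have hmX : Measurable fun ω => h (X ω) := hm.comp hX
  have hmY : Measurable fun ω => h (lam • Y ω) := hm.comp (hY.const_smul lam)
  have hiX : Integrable (fun ω => h (X ω)) μ := Integrable.of_bound (C := C)
    hmX.aestronglyMeasurable (ae_of_all _ fun ω => by rw [Real.norm_of_nonneg (h0 _)]; exact hC _)
  have hiY : Integrable (fun ω => h (lam • Y ω)) ν := Integrable.of_bound (C := C)
    hmY.aestronglyMeasurable (ae_of_all _ fun ω => by rw [Real.norm_of_nonneg (h0 _)]; exact hC _)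
  have key : ∫⁻ ω, ENNReal.ofReal (h (X ω)) ∂μ
      ≤ ENNReal.ofReal κ * ∫⁻ ω, ENNReal.ofReal (h (lam • Y ω)) ∂ν := by
    rw [lintegral_eq_lintegral_meas_lt μ (ae_of_all _ fun ω => h0 _) hmX.aemeasurable,
      lintegral_eq_lintegral_meas_lt ν (ae_of_all _ fun ω => h0 _) hmY.aemeasurable,
      ← lintegral_const_mul' _ _ ENNReal.ofReal_ne_top]
    refine lintegral_mono fun t => ?_
    have hd := hdom {x | h x ≤ t} (hlev t).1 (hlev t).2.1 fun x hx => by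
      rw [Set.mem_ofPred_eq, (hlev t).2.2]; exact hx
    simp only [Set.mem_ofPred_eq, not_le] at hd
    have hd' := ENNReal.ofReal_le_ofReal hd
    rwa [ENNReal.ofReal_mul hκ, ofReal_measureReal, ofReal_measureReal] at hd'
  rw [← ofReal_integral_eq_lintegral_ofReal hiX (ae_of_all _ fun ω => h0 _),
    ← ofReal_integral_eq_lintegral_ofReal hiY (ae_of_all _ fun ω => h0 _),
    ← ENNReal.ofReal_mul hκ] at key
  exact (ENNReal.ofReal_le_ofReal_iff
    (mul_nonneg hκ (integral_nonneg fun ω => h0 _))).1 key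

lemma IsEvenConvexLip.integrable [SecondCountableTopology E] [IsFiniteMeasure μ]
    (h : IsEvenConvexLip q φ) (hq : Continuous q) {X : Ω → E} (hX : Measurable X) {r : ℝ}
    (hr : ∀ ω, q (X ω) ≤ r) : Integrable (fun ω => φ (X ω)) μ :=
  Integrable.of_bound (C := |φ 0| + r)
    ((h.continuous hq).measurable.comp hX).aestronglyMeasurable
    (ae_of_all _ fun ω => (h.abs_le _).trans (by linarith [hr ω]))

/-- Comparison of a single dominated pair after truncation. The factor `κ ≤ m` is absorbed by the
convexity bound `φ x - φ 0 ≤ (φ (m • x) - φ 0) / m`. Truncating at `q ≤ lam` keeps the sublevel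
sets convex, at the cost of the mass of the large values of `Y`. -/
lemma IsDominatedBy.integral_trunc_le [SecondCountableTopology E] [IsProbabilityMeasure μ]
    [IsProbabilityMeasure ν] {κ lam m : ℝ}
    (hκ : 1 ≤ κ) (hm : κ ≤ m) (hlam : 1 ≤ lam)
    {X : Ω → E} {Y : Ω' → E} (hX : Measurable X) (hY : Measurable Y)
    (hdom : IsDominatedBy κ lam X μ Y ν) (hq : Continuous q) (hφ : IsEvenConvexLip q φ) :
    ∫ ω, φ (trunc q lam (X ω)) ∂μ ≤ ∫ ω, φ ((m * lam) • trunc q 1 (Y ω)) ∂ν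
      + m * lam * ν.real {ω | 1 < q (Y ω)} := by
  classical
  have hm0 : 0 < m := by linarith
  have hlam0 : 0 < lam := by linarith
  set g : E → ℝ := fun x => φ (m • x) - φ 0 with hg
  set h : E → ℝ := fun x => if q x ≤ lam then g x else m * lam with hh
  have hg0 : ∀ x, 0 ≤ g x := fun x => sub_nonneg.2 (hφ.zero_le _)
  have hgq : ∀ x, g x ≤ m * q x := fun x => by
    have := hφ.lip 0 (m • x)
    rw [zero_add, map_smul_eq_mul, Real.norm_of_nonneg hm0.le] at this
    simp only [hg]; linarith
  have hh0 : ∀ x, 0 ≤ h x := fun x => by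
    simp only [hh]; split_ifs
    · exact hg0 x
    · positivity
  have hhC : ∀ x, h x ≤ m * lam := fun x => by
    simp only [hh]; split_ifs with hx
    · exact (hgq x).trans (mul_le_mul_of_nonneg_left hx hm0.le)
    · exact le_rfl
  have hgcont : Continuous g :=
    ((hφ.continuous hq).comp (continuous_const_smul m)).sub continuous_const
  have hgconv : ConvexOn ℝ Set.univ g := by
    have h1 := hφ.convex.comp_linearMap (LinearMap.lsmul ℝ E m)
    exact h1.sub (concaveOn_const (φ 0) convex_univ)
  have hlev : ∀ t, IsClosed {x | h x ≤ t} ∧ Convex ℝ {x | h x ≤ t} ∧ ∀ x, h (-x) = h x := by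
    intro t
    have heven : ∀ x, h (-x) = h x := fun x => by
      simp only [hh, hg, map_neg_eq_map, smul_neg, hφ.even]
    rcases le_or_gt (m * lam) t with ht | ht
    · have : {x | h x ≤ t} = Set.univ := Set.eq_univ_of_forall fun x => (hhC x).trans ht
      rw [this]
      exact ⟨isClosed_univ, convex_univ, heven⟩
    · have : {x | h x ≤ t} = {x | g x ≤ t} ∩ {x | q x ≤ lam} := by
        ext x
        simp only [hh, Set.mem_ofPred_eq, Set.mem_inter_iff]
        split_ifs with hx
        · simp [hx]
        · simp [hx, ht]
      rw [this]
      refine ⟨(isClosed_le hgcont continuous_const).inter (isClosed_le hq continuous_const),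
        Convex.inter ?_ ?_, heven⟩
      · simpa using hgconv.convex_le t
      · simpa using q.convexOn.convex_le lam
  have hmain := hdom.integral_le (zero_le_one.trans hκ) hX hY hh0 hhC hlev
  have hTX : ∀ ω, q (trunc q lam (X ω)) ≤ lam := fun ω => seminorm_trunc_le q hlam0.le _
  have hTXm : Measurable fun ω => trunc q lam (X ω) := (measurable_trunc hq _).comp hX
  have hTYm : Measurable fun ω => (m * lam) • trunc q 1 (Y ω) :=
    ((measurable_trunc hq _).comp hY).const_smul _
  have hTY : ∀ ω, q ((m * lam) • trunc q 1 (Y ω)) ≤ m * lam := fun ω => by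
    rw [map_smul_eq_mul, Real.norm_of_nonneg (by positivity)]
    have := seminorm_trunc_le q zero_le_one (Y ω)
    nlinarith [mul_pos hm0 hlam0]
  have hhm : Measurable h := measurable_of_Iic fun t => (hlev t).1.measurableSet
  -- Left side: convexity turns the factor `m` into a gain `1 / m`.
  have hleft : m * (∫ ω, φ (trunc q lam (X ω)) ∂μ - φ 0) ≤ ∫ ω, h (X ω) ∂μ := by
    have hint := hφ.integrable (μ := μ) hq hTXm hTX
    have : ∫ ω, m * (φ (trunc q lam (X ω)) - φ 0) ∂μ ≤ ∫ ω, h (X ω) ∂μ := by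
      refine integral_mono ((hint.sub (integrable_const _)).const_mul m) ?_ fun ω => ?_
      · refine Integrable.of_bound (C := m * lam) (hhm.comp hX).aestronglyMeasurable
          (ae_of_all _ fun ω => by rw [Real.norm_of_nonneg (hh0 _)]; exact hhC _)
      rcases le_or_gt (q (X ω)) lam with hx | hx
      · simp only [hh, hx, if_true, trunc_of_le hx, hg]
        have hm1 : 1 ≤ m := hκ.trans hm
        have hc := hφ.convex.2 (Set.mem_univ (m • X ω)) (Set.mem_univ 0)
          (inv_nonneg.2 hm0.le) (sub_nonneg.2 (inv_le_one_of_one_le₀ hm1)) (by ring)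
        rw [smul_zero, add_zero, smul_smul, inv_mul_cancel₀ hm0.ne', one_smul, smul_eq_mul,
          smul_eq_mul] at hc
        have hc2 := mul_le_mul_of_nonneg_left hc hm0.le
        have : m * (m⁻¹ * φ (m • X ω) + (1 - m⁻¹) * φ 0) = φ (m • X ω) + (m - 1) * φ 0 := by
          field_simp
        rw [this] at hc2
        linarith
      · simp only [trunc_of_lt hx, sub_self, mul_zero]
        exact hh0 _
    rwa [integral_const_mul, integral_sub hint (integrable_const _), integral_const,
      probReal_univ, one_smul] at this
  have hright : ∫ ω, h (lam • Y ω) ∂ν ≤ ∫ ω, φ ((m * lam) • trunc q 1 (Y ω)) ∂ν - φ 0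
      + m * lam * ν.real {ω | 1 < q (Y ω)} := by
    have hint := hφ.integrable (μ := ν) hq hTYm hTY
    have hS : MeasurableSet {ω | 1 < q (Y ω)} :=
      measurableSet_lt measurable_const (hq.measurable.comp hY)
    have hint' : Integrable (fun ω => φ ((m * lam) • trunc q 1 (Y ω)) - φ 0) ν :=
      hint.sub (integrable_const _)
    have hind : Integrable ({ω | 1 < q (Y ω)}.indicator fun _ => m * lam) ν :=
      (integrable_const _).indicator hS
    have : ∫ ω, h (lam • Y ω) ∂ν ≤ ∫ ω, ((φ ((m * lam) • trunc q 1 (Y ω)) - φ 0)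
        + {ω | 1 < q (Y ω)}.indicator (fun _ => m * lam) ω) ∂ν := by
      refine integral_mono ?_ (hint'.add hind) fun ω => ?_
      · refine Integrable.of_bound (C := m * lam)
          (hhm.comp (hY.const_smul lam)).aestronglyMeasurable
          (ae_of_all _ fun ω => by rw [Real.norm_of_nonneg (hh0 _)]; exact hhC _)
      rcases le_or_gt (q (Y ω)) 1 with hy | hy
      · have hy' : q (lam • Y ω) ≤ lam := by
          rw [map_smul_eq_mul, Real.norm_of_nonneg hlam0.le]
          exact mul_le_of_le_one_right hlam0.le hy
        have hy2 : ω ∉ {ω | 1 < q (Y ω)} := not_lt.2 hy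
        simp only [hh, hy', if_true, trunc_of_le hy, hg, smul_smul,
          Set.indicator_of_notMem hy2, add_zero, le_refl]
      · have hy2 : ω ∈ {ω | 1 < q (Y ω)} := hy
        simp only [trunc_of_lt hy, smul_zero, sub_self, Set.indicator_of_mem hy2, zero_add]
        exact hhC _
    rwa [integral_add hint' hind,
      integral_sub hint (integrable_const _), integral_const, probReal_univ, one_smul,
      integral_indicator_const _ hS, smul_eq_mul, mul_comm (ν.real _)] at this
  have hR0 : 0 ≤ ∫ ω, h (lam • Y ω) ∂ν := integral_nonneg fun ω => hh0 _
  have h3 : m * (∫ ω, φ (trunc q lam (X ω)) ∂μ - φ 0) ≤ m * ∫ ω, h (lam • Y ω) ∂ν :=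
    hleft.trans (hmain.trans (mul_le_mul_of_nonneg_right hm hR0))
  linarith [le_of_mul_le_mul_left h3 hm0]

end Convex

/-! ### Replacing the summands one at a time -/

section Replace

variable {E : Type*} [NormedAddCommGroup E] [NormedSpace ℝ E] [MeasurableSpace E] [BorelSpace E]
  [SecondCountableTopology E] {q : Seminorm ℝ E} {φ : E → ℝ}
  {Ω Ω' : Type*} [MeasurableSpace Ω] [MeasurableSpace Ω'] {μ : Measure Ω} {ν : Measure Ω'}
  [IsProbabilityMeasure μ] [IsProbabilityMeasure ν]

lemma IsEvenConvexLip.integrable_add (h : IsEvenConvexLip q φ) (hq : Continuous q) {W : Ω → E}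
    (hW : Measurable W) {r : ℝ} (hr : ∀ ω, q (W ω) ≤ r) (x : E) :
    Integrable (fun ω => φ (x + W ω)) μ :=
  h.integrable hq (hW.const_add x) (r := q x + r) fun ω =>
    (map_add_le_add q _ _).trans (by linarith [hr ω])

/-- Averaging over a symmetric random translation preserves even convex Lipschitz functions. -/
lemma IsEvenConvexLip.average (h : IsEvenConvexLip q φ) (hq : Continuous q) {W : Ω → E}
    (hW : Measurable W) {r : ℝ} (hr : ∀ ω, q (W ω) ≤ r)
    (hsymm : IdentDistrib (fun ω => -W ω) W μ μ) :
    IsEvenConvexLip q fun x => ∫ ω, φ (x + W ω) ∂μ where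
  convex := by
    have hi := fun x => h.integrable_add (μ := μ) hq hW hr x
    refine ⟨convex_univ, fun x _ y _ a b ha hb hab => ?_⟩
    simp only [smul_eq_mul]
    rw [← integral_const_mul, ← integral_const_mul,
      ← integral_add ((hi x).const_mul a) ((hi y).const_mul b)]
    refine integral_mono (hi _) (((hi x).const_mul a).add ((hi y).const_mul b)) fun ω => ?_
    have hc := h.convex.2 (Set.mem_univ (x + W ω)) (Set.mem_univ (y + W ω)) ha hb hab
    have : a • (x + W ω) + b • (y + W ω) = a • x + b • y + W ω := by
      rw [smul_add, smul_add, add_add_add_comm, ← add_smul, hab, one_smul]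
    rw [this] at hc
    exact hc
  even x := by
    have hm : Measurable fun w => φ (x + w) :=
      (h.continuous hq).measurable.comp (measurable_id.const_add x)
    have := (hsymm.comp hm).integral_eq
    simp only [Function.comp_apply] at this
    rw [← this]
    refine integral_congr_ae (ae_of_all _ fun ω => ?_)
    simp only
    rw [← h.even, neg_add, neg_neg]
  lip x y := by
    have hi := fun x => h.integrable_add (μ := μ) hq hW hr x
    have : ∫ ω, φ (x + y + W ω) ∂μ ≤ ∫ ω, (φ (x + W ω) + q y) ∂μ := by
      refine integral_mono (hi _) ((hi x).add (integrable_const _)) fun ω => ?_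
      simp only
      rw [add_right_comm]
      exact h.lip _ _
    rwa [integral_add (hi x) (integrable_const _), integral_const, probReal_univ,
      one_smul] at this

lemma IsEvenConvexLip.integral_add_of_indepFun (h : IsEvenConvexLip q φ) (hq : Continuous q)
    {U W : Ω → E} (hU : Measurable U) (hW : Measurable W) {r r' : ℝ} (hUr : ∀ ω, q (U ω) ≤ r)
    (hWr : ∀ ω, q (W ω) ≤ r') (hUW : IndepFun U W μ) :
    ∫ ω, φ (U ω + W ω) ∂μ = ∫ ω, ∫ ω', φ (U ω + W ω') ∂μ ∂μ := by
  have hφm := (h.continuous hq).measurable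
  have hf : Measurable fun p : E × E => φ (p.1 + p.2) := hφm.comp (by fun_prop)
  have hp : Measurable fun ω => (U ω, W ω) := hU.prodMk hW
  have hint : Integrable (fun p : E × E => φ (p.1 + p.2)) (μ.map fun ω => (U ω, W ω)) := by
    rw [integrable_map_measure hf.aestronglyMeasurable hp.aemeasurable]
    exact h.integrable (r := r + r') hq (hU.add hW) fun ω =>
      (map_add_le_add q _ _).trans (add_le_add (hUr ω) (hWr ω))
  have hmap := hUW.map_prod_eq_prod_map_map hU.aemeasurable hW.aemeasurable
  have h1 : ∫ ω, φ (U ω + W ω) ∂μ = ∫ p, φ (p.1 + p.2) ∂(μ.map fun ω => (U ω, W ω)) :=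
    (integral_map hp.aemeasurable hf.aestronglyMeasurable).symm
  rw [hmap] at hint h1
  have : IsProbabilityMeasure (μ.map W) := Measure.isProbabilityMeasure_map hW.aemeasurable
  have : IsProbabilityMeasure (μ.map U) := Measure.isProbabilityMeasure_map hU.aemeasurable
  rw [h1, integral_prod _ hint, integral_map hU.aemeasurable
    hf.stronglyMeasurable.integral_prod_right.aestronglyMeasurable]
  refine integral_congr_ae (ae_of_all _ fun ω => ?_)
  exact integral_map hW.aemeasurable (hφm.comp (measurable_id.const_add _)).aestronglyMeasurable

/-- If each `V i` is larger than `U i` for even convex Lipschitz functions, up to an error `e i`,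
then so are the sums, up to the sum of the errors. -/
lemma integral_sum_le_of_forall {n : ℕ} {U : Fin n → Ω → E} {V : Fin n → Ω' → E}
    (hq : Continuous q) (hU : IndepSymm U μ) (hV : IndepSymm V ν) {r : ℝ}
    (hUr : ∀ i ω, q (U i ω) ≤ r) (hVr : ∀ i ω, q (V i ω) ≤ r) {e : Fin n → ℝ}
    (hstep : ∀ i (φ : E → ℝ), IsEvenConvexLip q φ →
      ∫ ω, φ (U i ω) ∂μ ≤ ∫ ω, φ (V i ω) ∂ν + e i) (s : Finset (Fin n)) :
    ∀ φ : E → ℝ, IsEvenConvexLip q φ →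
      ∫ ω, φ (∑ i ∈ s, U i ω) ∂μ ≤ ∫ ω, φ (∑ i ∈ s, V i ω) ∂ν + ∑ i ∈ s, e i := by
  induction s using Finset.induction_on with
  | empty => intro φ _; simp
  | insert a s ha ih =>
    intro φ hφ
    have hUs : Measurable fun ω => ∑ i ∈ s, U i ω := Finset.measurable_sum _ fun i _ => hU.meas i
    have hVs : Measurable fun ω => ∑ i ∈ s, V i ω := Finset.measurable_sum _ fun i _ => hV.meas i
    have hUb := fun ω => seminorm_sum_le hUr s ω
    have hVb := fun ω => seminorm_sum_le hVr s ω
    have hUi : IndepFun (U a) (fun ω => ∑ i ∈ s, U i ω) μ := by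
      have := (hU.indep.indepFun_finsetSum_of_notMem hU.meas ha).symm
      convert this using 1
      ext ω; simp
    have hVi : IndepFun (fun ω => ∑ i ∈ s, V i ω) (V a) ν := by
      have := hV.indep.indepFun_finsetSum_of_notMem hV.meas ha
      convert this using 1
      ext ω; simp
    have hφ₁ := hφ.average hq hUs hUb (hU.sum_symm s)
    have hφ₂ := hφ.average hq (hV.meas a) (hVr a) (hV.symm a)
    have hswap : ∫ ω', ∫ ω, φ (V a ω' + ∑ i ∈ s, U i ω) ∂μ ∂ν
        = ∫ ω, ∫ ω', φ (∑ i ∈ s, U i ω + V a ω') ∂ν ∂μ := by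
      rw [integral_integral_swap]
      · simp only [add_comm]
      · exact hφ.integrable (μ := ν.prod μ) (r := r + s.card * r) hq
          (((hV.meas a).comp measurable_fst).add (hUs.comp measurable_snd)) fun p =>
          (map_add_le_add q _ _).trans (add_le_add (hVr a p.1) (hUb p.2))
    simp only [Finset.sum_insert ha]
    calc ∫ ω, φ (U a ω + ∑ i ∈ s, U i ω) ∂μ
        = ∫ ω, ∫ ω', φ (U a ω + ∑ i ∈ s, U i ω') ∂μ ∂μ :=
          hφ.integral_add_of_indepFun hq (hU.meas a) hUs (hUr a) hUb hUi
      _ ≤ ∫ ω', ∫ ω, φ (V a ω' + ∑ i ∈ s, U i ω) ∂μ ∂ν + e a := hstep a _ hφ₁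
      _ = ∫ ω, ∫ ω', φ (∑ i ∈ s, U i ω + V a ω') ∂ν ∂μ + e a := by rw [hswap]
      _ ≤ ∫ ω, ∫ ω', φ (∑ i ∈ s, V i ω + V a ω') ∂ν ∂ν + ∑ i ∈ s, e i + e a := by
          linarith [ih _ hφ₂]
      _ = ∫ ω, φ (∑ i ∈ s, V i ω + V a ω) ∂ν + ∑ i ∈ s, e i + e a := by
          rw [hφ.integral_add_of_indepFun hq hVs (hV.meas a) hVb (hVr a) hVi]
      _ = ∫ ω, φ (V a ω + ∑ i ∈ s, V i ω) ∂ν + (e a + ∑ i ∈ s, e i) := by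
          simp only [add_comm, add_assoc]

end Replace

/-! ### Comparison of the tails of the sums -/

section Main

variable {E : Type*} [NormedAddCommGroup E] [NormedSpace ℝ E] [MeasurableSpace E] [BorelSpace E]
  [SecondCountableTopology E]
  {Ω Ω' : Type*} [MeasurableSpace Ω] [MeasurableSpace Ω'] {μ : Measure Ω} {ν : Measure Ω'}
  [IsProbabilityMeasure μ] [IsProbabilityMeasure ν]

/-- The tail comparison for the balls of a continuous seminorm. -/
lemma tail_sum_le_of_seminorm {n : ℕ} {X : Fin n → Ω → E} {Y : Fin n → Ω' → E}
    (hX : IndepSymm X μ) (hY : IndepSymm Y ν) {κ lam m α : ℝ} (hκ : 1 ≤ κ) (hm : κ ≤ m)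
    (hlam : 1 ≤ lam) (hdom : ∀ i, IsDominatedBy κ lam (X i) μ (Y i) ν) (hα : 0 < α)
    (hα1 : α ≤ 1) {q : Seminorm ℝ E} (hq : Continuous q) :
    μ.real {ω | (1 + α) * m * lam < q (∑ i, X i ω)}
      ≤ 16 * α⁻¹ * m * ν.real {ω | 1 < q (∑ i, Y i ω)} := by
  set p := ν.real {ω | 1 < q (∑ i, Y i ω)} with hp
  have hp0 : 0 ≤ p := measureReal_nonneg
  have hm1 : 1 ≤ m := hκ.trans hm
  have hm0 : 0 < m := by linarith
  have hlam0 : 0 < lam := by linarith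
  have hβ1 : 1 ≤ α⁻¹ := (one_le_inv₀ hα).2 hα1
  rcases le_or_gt 1 (16 * α⁻¹ * m * p) with hbig | hsmall
  · exact measureReal_le_one.trans hbig
  have hp16 : p < 1 / 16 := by
    have h1 : 1 ≤ α⁻¹ * m := one_le_mul_of_one_le_of_one_le hβ1 hm1
    nlinarith
  -- The two small-probability estimates on the side of `Y`.
  have hlarge : ∑ i, ν.real {ω | 1 < q (Y i ω)} ≤ 16 / 7 * p := by
    refine (hY.sum_measure_le hq le_rfl (by linarith)).trans ?_
    rw [← hp, div_le_iff₀ (by linarith)]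
    nlinarith
  have hexc : ∫ ω, max (q (∑ i, trunc q 1 (Y i ω)) - 1) 0 ∂ν ≤ 32 / 3 * p := by
    refine ((hY.comp_trunc hq 1).integral_excess_le hq
      (fun i ω => seminorm_trunc_le q zero_le_one _)
      (hY.measure_sum_trunc_le hq) (by rw [← hp]; linarith)).trans ?_
    rw [← hp, div_le_iff₀ (by linarith)]
    nlinarith
  have hXlarge : ∀ i, μ.real {ω | lam < q (X i ω)} ≤ m * ν.real {ω | 1 < q (Y i ω)} := by
    intro i
    have h := hdom i {x | q x ≤ lam} (isClosed_le hq continuous_const)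
      (by simpa using q.convexOn.convex_le lam) fun x hx => by
        rw [Set.mem_ofPred_eq, map_neg_eq_map]; exact hx
    simp only [Set.mem_ofPred_eq, not_le, map_smul_eq_mul, Real.norm_of_nonneg hlam0.le] at h
    simp only [lt_mul_iff_one_lt_right hlam0] at h
    exact h.trans (mul_le_mul_of_nonneg_right hm measureReal_nonneg)
  -- Comparison of the expected excesses of the truncated sums.
  have hcomp : ∫ ω, max (q (∑ i, trunc q lam (X i ω)) - m * lam) 0 ∂μ
      ≤ m * lam * (32 / 3 * p) + m * lam * (16 / 7 * p) := by
    have hV : IndepSymm (fun i ω => (m * lam) • trunc q 1 (Y i ω)) ν :=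
      (hY.comp_trunc hq 1).comp_odd (f := fun x => (m * lam) • x) (measurable_const_smul _)
        fun x => smul_neg _ _
    have h := integral_sum_le_of_forall hq (hX.comp_trunc hq lam) hV (r := m * lam)
      (fun i ω => (seminorm_trunc_le q hlam0.le _).trans (by nlinarith))
      (fun i ω => by
        rw [map_smul_eq_mul, Real.norm_of_nonneg (by positivity)]
        exact mul_le_of_le_one_right (by positivity) (seminorm_trunc_le q zero_le_one _))
      (e := fun i => m * lam * ν.real {ω | 1 < q (Y i ω)})
      (fun i φ hφ => (hdom i).integral_trunc_le hκ hm hlam (hX.meas i) (hY.meas i) hq hφ)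
      Finset.univ _ (isEvenConvexLip_excess q (m * lam))
    have hscale : ∀ ω, max (q (∑ i, (m * lam) • trunc q 1 (Y i ω)) - m * lam) 0
        = m * lam * max (q (∑ i, trunc q 1 (Y i ω)) - 1) 0 := fun ω => by
      rw [← Finset.smul_sum, map_smul_eq_mul, Real.norm_of_nonneg (by positivity),
        mul_max_of_nonneg _ _ (by positivity), mul_sub, mul_one, mul_zero]
    simp only [hscale, integral_const_mul, ← Finset.mul_sum] at h
    refine h.trans (add_le_add ?_ ?_) <;>
      exact mul_le_mul_of_nonneg_left (by assumption) (by positivity)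
  have hmarkov : μ.real {ω | (1 + α) * m * lam < q (∑ i, trunc q lam (X i ω))}
      ≤ α⁻¹ * (32 / 3 * p + 16 / 7 * p) := by
    have hXT := hX.comp_trunc hq lam
    have hint := (isEvenConvexLip_excess q (m * lam)).integrable (μ := μ) hq
      (X := fun ω => ∑ i, trunc q lam (X i ω)) (Finset.measurable_sum _ fun i _ => hXT.meas i)
      fun ω => seminorm_sum_le (fun i ω => seminorm_trunc_le q hlam0.le (X i ω)) Finset.univ ω
    have h := mul_meas_ge_le_integral_of_nonneg (μ := μ)
      (ae_of_all _ fun ω => le_max_right (q (∑ i, trunc q lam (X i ω)) - m * lam) 0) hint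
      (α * m * lam)
    have hsub : μ.real {ω | (1 + α) * m * lam < q (∑ i, trunc q lam (X i ω))}
        ≤ μ.real {ω | α * m * lam ≤ max (q (∑ i, trunc q lam (X i ω)) - m * lam) 0} := by
      refine measureReal_mono (μ := μ) fun ω hω => ?_
      rw [Set.mem_ofPred_eq] at hω ⊢
      refine le_max_of_le_left ?_
      linarith
    have hpos : 0 < α * m * lam := by positivity
    refine hsub.trans (le_of_mul_le_mul_left ((h.trans hcomp).trans_eq ?_) hpos)
    field_simp
  have hunion : μ.real {ω | (1 + α) * m * lam < q (∑ i, X i ω)}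
      ≤ ∑ i, μ.real {ω | lam < q (X i ω)}
        + μ.real {ω | (1 + α) * m * lam < q (∑ i, trunc q lam (X i ω))} := by
    calc _ ≤ μ.real ((⋃ i, {ω | lam < q (X i ω)}) ∪
          {ω | (1 + α) * m * lam < q (∑ i, trunc q lam (X i ω))}) := by
          refine measureReal_mono (μ := μ) fun ω hω => ?_
          by_cases h : ∃ i, lam < q (X i ω)
          · exact Or.inl (Set.mem_iUnion.2 h)
          · push Not at h
            right
            rw [Set.mem_ofPred_eq, Finset.sum_congr rfl fun i _ => trunc_of_le (h i)]
            exact hω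
      _ ≤ _ := (measureReal_union_le _ _).trans
          (add_le_add (measureReal_iUnion_fintype_le (μ := μ) _) le_rfl)
  have hXsum : ∑ i, μ.real {ω | lam < q (X i ω)} ≤ m * (16 / 7 * p) := by
    refine (Finset.sum_le_sum fun i _ => hXlarge i).trans ?_
    rw [← Finset.mul_sum]
    exact mul_le_mul_of_nonneg_left hlarge hm0.le
  -- `16/7 + 32/3 + 16/7 < 16`.
  have h1 : m * p ≤ α⁻¹ * m * p := by
    rw [mul_assoc]; exact le_mul_of_one_le_left (by positivity) hβ1
  have h2 : α⁻¹ * p ≤ α⁻¹ * m * p := by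
    rw [mul_right_comm]; exact le_mul_of_one_le_right (by positivity) hm1
  have h3 : 0 ≤ α⁻¹ * m * p := by positivity
  nlinarith

/-- The tail comparison for closed convex symmetric neighbourhoods of `0`, through the gauge. -/
lemma tail_sum_le_of_mem_nhds {n : ℕ} {X : Fin n → Ω → E} {Y : Fin n → Ω' → E}
    (hX : IndepSymm X μ) (hY : IndepSymm Y ν) {κ lam m α : ℝ} (hκ : 1 ≤ κ) (hm : κ ≤ m)
    (hlam : 1 ≤ lam) (hdom : ∀ i, IsDominatedBy κ lam (X i) μ (Y i) ν) (hα : 0 < α)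
    (hα1 : α ≤ 1) {K : Set E} (hKc : IsClosed K) (hK : Convex ℝ K) (hsymm : ∀ x ∈ K, -x ∈ K)
    (h0 : K ∈ nhds 0) :
    μ.real {ω | ∑ i, X i ω ∉ K}
      ≤ 16 * α⁻¹ * m * ν.real {ω | ((1 + α) * m * lam) • ∑ i, Y i ω ∉ K} := by
  set c : ℝ := (1 + α) * m * lam with hc
  have hc0 : 0 < c := by
    have : 0 < m := by linarith
    have : 0 < lam := by linarith
    positivity
  have hbal : Balanced ℝ K := by
    refine (balanced_iff_smul_mem).2 fun a ha x hx => ?_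
    rw [Real.norm_eq_abs, abs_le] at ha
    have h1 := hK hx (hsymm x hx) (a := (1 + a) / 2) (b := (1 - a) / 2) (by linarith)
      (by linarith) (by ring)
    rwa [smul_neg, ← sub_eq_add_neg, ← sub_smul, show (1 + a) / 2 - (1 - a) / 2 = a by ring] at h1
  set q₀ : Seminorm ℝ E := gaugeSeminorm hbal hK (absorbent_nhds_zero h0) with hq₀
  have hmem : ∀ x, x ∉ K ↔ 1 < q₀ x := fun x => by
    have := gauge_le_one_iff_mem_closure (x := x) hK h0
    rw [hKc.closure_eq] at this
    rw [← this, not_le]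
    rfl
  have hq : Continuous (c.toNNReal • q₀ : Seminorm ℝ E) := by
    have h1 : Continuous q₀ := continuous_gauge hK h0
    exact h1.const_smul c.toNNReal
  have hval : ∀ x, (c.toNNReal • q₀ : Seminorm ℝ E) x = c * q₀ x := fun x => by
    rw [smul_apply, NNReal.smul_def, Real.coe_toNNReal _ hc0.le, smul_eq_mul]
  have h := tail_sum_le_of_seminorm hX hY hκ hm hlam hdom hα hα1 hq
  simp only [hval] at h
  rw [← hc] at h
  simp only [lt_mul_iff_one_lt_right hc0] at h
  simpa only [hmem, map_smul_eq_mul, Real.norm_of_nonneg hc0.le] using h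

end Main

/-! ### Reduction to neighbourhoods of the origin -/

lemma neg_mem_cthickening {E : Type*} [NormedAddCommGroup E] {K : Set E} (hsymm : ∀ x ∈ K, -x ∈ K) (δ : ℝ) :
    ∀ x ∈ Metric.cthickening δ K, -x ∈ Metric.cthickening δ K := by
  intro x hx
  have hneg : (fun x : E => -x) '' K = K := by
    ext y
    exact ⟨by rintro ⟨z, hz, rfl⟩; exact hsymm z hz, fun hy => ⟨-y, hsymm y hy, neg_neg y⟩⟩
  rw [Metric.mem_cthickening_iff] at hx ⊢
  have h := Metric.infEDist_image (isometry_neg (G := E)) (x := x) (t := K)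
  rw [hneg] at h
  rwa [h]

theorem theorem1 {E : Type*} [NormedAddCommGroup E] [NormedSpace ℝ E] [CompleteSpace E]
    [TopologicalSpace.SeparableSpace E] [MeasurableSpace E] [BorelSpace E]
    {Ω Ω' : Type*} [MeasurableSpace Ω] [MeasurableSpace Ω']
    (μ : Measure Ω) [IsProbabilityMeasure μ] (ν : Measure Ω') [IsProbabilityMeasure ν]
    (n : ℕ) (X : Fin n → Ω → E) (Y : Fin n → Ω' → E)
    (hXm : ∀ i, Measurable (X i)) (hYm : ∀ i, Measurable (Y i))
    (hXind : iIndepFun X μ) (hYind : iIndepFun Y ν)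
    (hXsymm : ∀ i, IsSymmetricRV (X i) μ) (hYsymm : ∀ i, IsSymmetricRV (Y i) ν)
    (κ lam : ℝ) (hκ : 1 ≤ κ) (hlam : 1 ≤ lam)
    (hdom : ∀ i, IsDominatedBy κ lam (X i) μ (Y i) ν) :
    ∀ α : ℝ, 0 < α → α ≤ 1 →
      IsDominatedBy (16 * α⁻¹ * (⌈κ⌉ : ℝ)) ((1 + α) * (⌈κ⌉ : ℝ) * lam)
        (fun ω => ∑ i, X i ω) μ (fun ω => ∑ i, Y i ω) ν := by
  intro α hα hα1 K hKc hK hsymm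
  have : SecondCountableTopology E := UniformSpace.secondCountable_of_separable E
  have hX : IndepSymm X μ := ⟨hXm, hXind, hXsymm⟩
  have hY : IndepSymm Y ν := ⟨hYm, hYind, hYsymm⟩
  have hm : κ ≤ (⌈κ⌉ : ℝ) := Int.le_ceil κ
  have hC0 : 1 ≤ 16 * α⁻¹ * (⌈κ⌉ : ℝ) := by
    have := one_le_mul_of_one_le_of_one_le ((one_le_inv₀ hα).2 hα1) (hκ.trans hm)
    linarith
  rcases K.eq_empty_or_nonempty with rfl | ⟨x₀, hx₀⟩
  · simpa using hC0
  have h0K : (0 : E) ∈ K := by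
    have h1 := hK hx₀ (hsymm x₀ hx₀) (show (0 : ℝ) ≤ 1 / 2 by norm_num)
      (show (0 : ℝ) ≤ 1 / 2 by norm_num) (by norm_num)
    rwa [smul_neg, add_neg_cancel] at h1
  -- `K` may have empty interior, so it is approximated by its closed thickenings.
  set δ : ℕ → ℝ := fun k => 1 / ((k : ℝ) + 1) with hδ
  have hδ0 : ∀ k, 0 < δ k := fun k => Nat.one_div_pos_of_nat
  have hbound : ∀ k, μ.real {ω | ∑ i, X i ω ∉ Metric.cthickening (δ k) K}
      ≤ 16 * α⁻¹ * (⌈κ⌉ : ℝ) *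
        ν.real {ω | ((1 + α) * (⌈κ⌉ : ℝ) * lam) • ∑ i, Y i ω ∉ K} := by
    intro k
    refine (tail_sum_le_of_mem_nhds hX hY hκ hm hlam hdom hα hα1 Metric.isClosed_cthickening
      (hK.cthickening _) (neg_mem_cthickening hsymm _) ?_).trans ?_
    · exact Filter.mem_of_superset
        (mem_nhdsSet_iff_forall.1 (Metric.thickening_mem_nhdsSet K (hδ0 k)) 0 h0K)
        (Metric.thickening_subset_cthickening _ _)
    · refine mul_le_mul_of_nonneg_left (measureReal_mono (μ := ν) fun ω hω => ?_)
        (zero_le_one.trans hC0)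
      exact fun h => hω (Metric.self_subset_cthickening K h)
  have hδanti : Antitone δ := fun j k hjk => Nat.one_div_le_one_div hjk
  have hmono : Monotone fun k => {ω | ∑ i, X i ω ∉ Metric.cthickening (δ k) K} :=
    fun j k hjk ω hω h => hω (Metric.cthickening_mono (hδanti hjk) K h)
  have hunion : {ω | ∑ i, X i ω ∉ K} = ⋃ k, {ω | ∑ i, X i ω ∉ Metric.cthickening (δ k) K} := by
    ext ω
    simp only [Set.mem_ofPred_eq, Set.mem_iUnion]
    constructor
    · intro hω
      by_contra! hcon
      refine hω (hKc.closure_eq ▸ ?_)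
      rw [Metric.closure_eq_iInter_cthickening, Set.mem_iInter₂]
      intro ε hε
      obtain ⟨k, hk⟩ := exists_nat_one_div_lt hε
      exact Metric.cthickening_mono hk.le K (hcon k)
    · rintro ⟨k, hk⟩ h
      exact hk (Metric.self_subset_cthickening K h)
  have hlim := tendsto_measure_iUnion_atTop (μ := μ) hmono
  rw [← hunion] at hlim
  exact le_of_tendsto ((ENNReal.tendsto_toReal (measure_ne_top μ _)).comp hlim)
    (Filter.Eventually.of_forall hbound)
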